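/- **Theorem (Strong Regularization).** Let $\mathbb{K}$ be a field of characteristic $0$ and $\mathbb{K}[\boldsymbol{x}]=\mathbb{K}[x_1,\dots,x_n]$ with $x_1<\dots<x_n$; Gröbner bases are taken with respect to the lexicographical term order. For $F\in\mathbb{K}[\boldsymbol{x}]\setminus\mathbb{K}$, let $\mathrm{lv}(F)$ be the greatest variable occurring in $F$ and let the initial $\mathrm{ini}(F)$ be the leading coefficient of $F$ regarded as a polynomial in $\mathrm{lv}(F)$. A *triangular set* is a finite ordered set $[T_1,\dots,T_r]$ of non-constant polynomials with $\mathrm{lv}(T_1)<\dots<\mathrm{lv}(T_r)$; the empty set ($r=0$) is allowed. Its *saturated ideal* is $$\mathrm{sat}([T_1,\dots,T_r])=\{P\in\mathbb{K}[\boldsymbol{x}] : P\,J^i\in\langle T_1,\dots,T_r\rangle\text{ for some } i\ge 0\},\qquad J=\mathrm{ini}(T_1)\cdots\mathrm{ini}(T_r),$$ so $\mathrm{sat}(\emptyset)=\langle 0\rangle$; one also puts $\mathrm{sat}([1])=\langle 1\rangle$. A triangular set $[T_1,\dots,T_r]$ is *regular* if, for every $k=1,\dots,r$, $\mathrm{ini}(T_k)$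 is neither zero nor a zero divisor in $\mathbb{K}[\boldsymbol{x}]/\mathrm{sat}([T_1,\dots,T_{k-1}])$ (so the empty set is regular). The *W-characteristic set* $\mathrm{W\text{-}char}(I)$ of an ideal $I$ is $[1]$ if $I=\langle 1\rangle$; otherwise it consists, for each variable $x_j$ that is the leading variable of some element of the reduced lexicographical Gröbner basis $G$ of $I$, of the element of $G$ with leading variable $x_j$ that has the smallest leading term, ordered by increasing leading variables. A pair $(G,C)$ is a *strong regular characteristic pair* if $G$ is the reduced lexicographical Gröbner basis of $\langle G\rangle$, $C=\mathrm{W\text{-}char}(\langle G\rangle)$, $\mathrm{sat}(C)=\langle G\rangle$, and either $C$ is regular or $(G,C)$ is the trivial pair $(\{1\},[1])$. Let $I\subseteq\mathbb{K}[\boldsymbol{x}]$ be any ideal. Let $C_1=\mathrm{W\text{-}char}(I)$ and, for $i\ge 2$, let $G_i$ be the reduced lexicographical Gröbner basis of $\mathrm{sat}(C_{i-1})$ and $C_i=\mathrm{W\text{-}char}(\langle G_i\rangle)$. Then there is an integer $m\ge 2$ such that $$I\subseteq\mathrm{sat}(C_1)\subseteq\mathrm{sat}(C_m),$$ either $C_m$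 is a regular set or $\mathrm{sat}(C_m)=\langle 1\rangle$, and, for this same $m$, $(G_m,C_m)$ is a strong regular characteristic pair. -/

import Mathlib

open MvPolynomial
open scoped MonomialOrder

namespace StrongRegularization

/-- The lexicographic term order on the monomials in `x_0 < x_1 < ⋯ < x_{n-1}`: two exponent
vectors are compared at the largest index where they differ. -/
noncomputable def lexOrder (n : ℕ) : MonomialOrder (Fin n) where
  syn := Colex (Fin n →₀ ℕ)
  toSyn :=
    { toEquiv := toColex
      map_add' := fun _ _ => rfl }
  toSyn_monotone := Finsupp.toColex_monotone

theorem lexOrder_lt_iff {n : ℕ} {a b : Fin n →₀ ℕ} :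
    a ≺[lexOrder n] b ↔ ∃ i, (∀ j, i < j → a j = b j) ∧ a i < b i :=
  Iff.rfl

section Definitions

variable {n : ℕ} {K : Type*} [Field K]

/-- The leading variable of `F`: the greatest variable occurring in `F`, and `⊥` if `F` is
constant. -/
noncomputable def lv (F : MvPolynomial (Fin n) K) : WithBot (Fin n) :=
  F.vars.max

/-- The initial of `F`: its leading coefficient as a polynomial in its leading variable `x_i`.
It collects the terms of `F` of maximal degree in `x_i`, with that power of `x_i` removed.
For constant `F` it is `F` itself. -/
noncomputable def ini (F : MvPolynomial (Fin n) K) : MvPolynomial (Fin n) K :=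
  match lv F with
  | ⊥ => F
  | (i : Fin n) =>
      ∑ a ∈ F.support.filter (fun a => a i = F.degreeOf i), monomial (a.erase i) (F.coeff a)

/-- A triangular set, whose elements are ordered by their (distinct) leading variables.
The empty set is allowed. -/
def IsTriangularSet (T : Finset (MvPolynomial (Fin n) K)) : Prop :=
  (∀ F ∈ T, lv F ≠ ⊥) ∧ Set.InjOn lv (T : Set (MvPolynomial (Fin n) K))

/-- The saturated ideal of `T`: all `P` with `P * J ^ i ∈ ⟨T⟩` for some `i`, where `J` is the
product of the initials. It is `0` for `T = ∅`, and the unit ideal for `T = {c}` with a nonzero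
constant `c`. -/
noncomputable def sat (T : Finset (MvPolynomial (Fin n) K)) : Ideal (MvPolynomial (Fin n) K) where
  carrier := {P | ∃ i : ℕ,
    P * (∏ F ∈ T, ini F) ^ i ∈ Ideal.span (T : Set (MvPolynomial (Fin n) K))}
  zero_mem' := ⟨0, by simp⟩
  add_mem' := by
    rintro P Q ⟨i, hi⟩ ⟨j, hj⟩
    refine ⟨i + j, ?_⟩
    have h1 := Ideal.mul_mem_right ((∏ F ∈ T, ini F) ^ j) _ hi
    have h2 := Ideal.mul_mem_right ((∏ F ∈ T, ini F) ^ i) _ hj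
    have h3 := add_mem h1 h2
    convert h3 using 1
    ring
  smul_mem' := by
    rintro Q P ⟨i, hi⟩
    refine ⟨i, ?_⟩
    rw [smul_eq_mul, mul_assoc]
    exact Ideal.mul_mem_left _ _ hi

open Classical in
/-- A regular set `[T_1, …, T_r]`: the initial of each `T_k` is neither zero nor a zero divisor
modulo the saturated ideal of `[T_1, …, T_{k-1}]`. -/
def IsRegularSet (T : Finset (MvPolynomial (Fin n) K)) : Prop :=
  IsTriangularSet T ∧ ∀ F ∈ T,
    let S := sat (T.filter (fun P => lv P < lv F))
    Ideal.Quotient.mk S (ini F) ≠ 0 ∧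
      Ideal.Quotient.mk S (ini F) ∈ nonZeroDivisors (MvPolynomial (Fin n) K ⧸ S)

/-- `G` is a lexicographical Gröbner basis of `I`. -/
def IsGroebnerBasis (G : Finset (MvPolynomial (Fin n) K))
    (I : Ideal (MvPolynomial (Fin n) K)) : Prop :=
  (∀ g ∈ G, g ∈ I) ∧
    Ideal.span ((lexOrder n).leadingTerm '' (G : Set (MvPolynomial (Fin n) K))) =
      Ideal.span ((lexOrder n).leadingTerm '' (I : Set (MvPolynomial (Fin n) K)))

/-- `G` is a reduced lexicographical Gröbner basis of `I`: its elements are monic, and no term of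
an element is divisible by the leading term of another element. -/
def IsReducedGroebnerBasis (G : Finset (MvPolynomial (Fin n) K))
    (I : Ideal (MvPolynomial (Fin n) K)) : Prop :=
  IsGroebnerBasis G I ∧ (∀ g ∈ G, (lexOrder n).Monic g) ∧
    ∀ g ∈ G, ∀ h ∈ G, h ≠ g → ∀ a ∈ g.support, ¬ (lexOrder n).degree h ≤ a

section ExistenceUniqueness

theorem span_leadingTerm_eq (S : Set (MvPolynomial (Fin n) K)) :
    Ideal.span ((lexOrder n).leadingTerm '' S) =
      Ideal.span ((fun a => monomial a (1 : K)) '' {a | ∃ f ∈ S, f ≠ 0 ∧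
        (lexOrder n).degree f = a}) := by
  apply le_antisymm
  · rw [Ideal.span_le]
    rintro _ ⟨f, hf, rfl⟩
    by_cases h0 : f = 0
    · simp [h0]
    · rw [← MonomialOrder.C_mul_leadingCoeff_monomial_degree]
      exact Ideal.mul_mem_left _ _ (Ideal.subset_span ⟨_, ⟨f, hf, h0, rfl⟩, rfl⟩)
  · rw [Ideal.span_le]
    rintro _ ⟨_, ⟨f, hf, h0, rfl⟩, rfl⟩
    have h1 : (lexOrder n).leadingCoeff f ≠ 0 := by simpa using h0
    have h2 : monomial ((lexOrder n).degree f) (1 : K) =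
        C ((lexOrder n).leadingCoeff f)⁻¹ * (lexOrder n).leadingTerm f := by
      rw [MonomialOrder.leadingTerm, C_mul_monomial, inv_mul_cancel₀ h1]
    change monomial ((lexOrder n).degree f) (1 : K) ∈ _
    rw [h2]
    exact Ideal.mul_mem_left _ _ (Ideal.subset_span ⟨f, hf, rfl⟩)

theorem span_leadingTerm_le_iff (S S' : Set (MvPolynomial (Fin n) K)) :
    Ideal.span ((lexOrder n).leadingTerm '' S) ≤ Ideal.span ((lexOrder n).leadingTerm '' S') ↔
      ∀ f ∈ S, f ≠ 0 → ∃ g ∈ S', g ≠ 0 ∧ (lexOrder n).degree g ≤ (lexOrder n).degree f := by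
  rw [span_leadingTerm_eq S, span_leadingTerm_eq S', Ideal.span_le]
  constructor
  · intro h f hf h0
    have h1 := h ⟨_, ⟨f, hf, h0, rfl⟩, rfl⟩
    rw [SetLike.mem_coe, mem_ideal_span_monomial_image] at h1
    obtain ⟨_, ⟨g, hg, hg0, rfl⟩, hle⟩ := h1 ((lexOrder n).degree f) (by simp [mem_support_iff])
    exact ⟨g, hg, hg0, hle⟩
  · rintro h _ ⟨_, ⟨f, hf, h0, rfl⟩, rfl⟩
    rw [SetLike.mem_coe, mem_ideal_span_monomial_image]
    intro a ha
    obtain ⟨g, hg, hg0, hle⟩ := h f hf h0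
    have hae : a = (lexOrder n).degree f := by
      by_contra hne
      rw [mem_support_iff, coeff_monomial, if_neg (fun h => hne h.symm)] at ha
      exact ha rfl
    exact ⟨_, ⟨g, hg, hg0, rfl⟩, hae ▸ hle⟩

theorem exists_normal_element (I : Ideal (MvPolynomial (Fin n) K)) (a : Fin n →₀ ℕ)
    (ha : ∃ f ∈ I, f ≠ 0 ∧ (lexOrder n).degree f = a) :
    ∃ g ∈ I, (lexOrder n).degree g = a ∧ (lexOrder n).Monic g ∧
      ∀ c ∈ g.support, c ≠ a → ∀ f ∈ I, f ≠ 0 → ¬ (lexOrder n).degree f ≤ c := by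
  classical
  obtain ⟨q, r, hqr, -, hr⟩ := (lexOrder n).div_set
    (B := {f : MvPolynomial (Fin n) K | f ∈ I ∧ f ≠ 0})
    (fun b hb => by simpa using hb.2) (monomial a (1 : K))
  have hmem : monomial a (1 : K) - r ∈ I := by
    rw [hqr, add_sub_cancel_right, Finsupp.linearCombination_apply]
    exact Submodule.sum_mem _ fun b _ => Ideal.mul_mem_left _ _ b.2.1
  have hra : r.coeff a = 0 := by
    by_contra h
    obtain ⟨f, hf, hf0, hfa⟩ := ha
    exact hr a (mem_support_iff.mpr h) f ⟨hf, hf0⟩ hfa.le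
  have hca : (monomial a (1 : K) - r).coeff a = 1 := by simp [hra]
  have hne : monomial a (1 : K) - r ≠ 0 := by
    intro h
    rw [h] at hca
    simp at hca
  have hsupp : ∀ c ∈ (monomial a (1 : K) - r).support, c ≠ a → c ∈ r.support := by
    intro c hc hca
    rw [mem_support_iff, coeff_sub, coeff_monomial, if_neg (fun h => hca h.symm), zero_sub,
      neg_ne_zero] at hc
    exact mem_support_iff.mpr hc
  have hdeg : (lexOrder n).degree (monomial a (1 : K) - r) = a := by
    by_contra h
    exact hr _ (hsupp _ ((lexOrder n).degree_mem_support hne) h) _ ⟨hmem, hne⟩ le_rfl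
  refine ⟨_, hmem, hdeg, ?_, fun c hc hca f hf hf0 => hr c (hsupp c hc hca) f ⟨hf, hf0⟩⟩
  rw [MonomialOrder.Monic, MonomialOrder.leadingCoeff, hdeg, hca]

theorem exists_isReducedGroebnerBasis (I : Ideal (MvPolynomial (Fin n) K)) :
    ∃ G, IsReducedGroebnerBasis G I := by
  classical
  set L : Set (Fin n →₀ ℕ) := {a | ∃ f ∈ I, f ≠ 0 ∧ (lexOrder n).degree f = a} with hL
  have hanti : IsAntichain (· ≤ ·) {a | Minimal (· ∈ L) a} := setOfPred_minimal_antichain _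
  have hfin : {a | Minimal (· ∈ L) a}.Finite :=
    hanti.finite_of_wellQuasiOrdered wellQuasiOrdered_le
  choose! g hgI hgdeg hgmon hgred using exists_normal_element I
  have hg0 : ∀ a ∈ L, g a ≠ 0 := fun a ha => (hgmon a ha).ne_zero
  refine ⟨hfin.toFinset.image g, ⟨?_, le_antisymm ?_ ?_⟩, ?_, ?_⟩
  · intro f hf
    obtain ⟨a, ha, rfl⟩ := Finset.mem_image.mp hf
    exact hgI a (hfin.mem_toFinset.mp ha).prop
  · apply Ideal.span_mono
    apply Set.image_mono
    intro f hf
    obtain ⟨a, ha, rfl⟩ := Finset.mem_image.mp hf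
    exact hgI a (hfin.mem_toFinset.mp ha).prop
  · rw [span_leadingTerm_le_iff]
    intro f hf hf0
    obtain ⟨a, hle, hmin⟩ := exists_minimal_le_of_wellFoundedLT (· ∈ L)
      ((lexOrder n).degree f) ⟨f, hf, hf0, rfl⟩
    refine ⟨g a, ?_, hg0 a hmin.prop, (hgdeg a hmin.prop).symm ▸ hle⟩
    exact Finset.mem_coe.mpr (Finset.mem_image_of_mem g (hfin.mem_toFinset.mpr hmin))
  · intro f hf
    obtain ⟨a, ha, rfl⟩ := Finset.mem_image.mp hf
    exact hgmon a (hfin.mem_toFinset.mp ha).prop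
  · intro f hf h hh hne c hc hle
    obtain ⟨a, ha, rfl⟩ := Finset.mem_image.mp hf
    obtain ⟨b, hb, rfl⟩ := Finset.mem_image.mp hh
    have ha' := hfin.mem_toFinset.mp ha
    have hb' := hfin.mem_toFinset.mp hb
    by_cases hca : c = a
    · subst hca
      rw [hgdeg b hb'.prop] at hle
      exact hne (by rw [le_antisymm hle (ha'.le_of_le hb'.prop hle)])
    · exact hgred a ha'.prop c hc hca _ (hgI b hb'.prop) (hg0 b hb'.prop) hle

theorem IsReducedGroebnerBasis.subset {G G' : Finset (MvPolynomial (Fin n) K)}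
    {I : Ideal (MvPolynomial (Fin n) K)} (hG : IsReducedGroebnerBasis G I)
    (hG' : IsReducedGroebnerBasis G' I) : G ⊆ G' := by
  obtain ⟨⟨hGI, hGs⟩, hGm, hGr⟩ := hG
  obtain ⟨⟨hGI', hGs'⟩, hGm', hGr'⟩ := hG'
  have hd := (span_leadingTerm_le_iff _ _).mp hGs.ge
  have hd' := (span_leadingTerm_le_iff _ _).mp hGs'.ge
  intro g hg
  have hg0 : g ≠ 0 := (hGm g hg).ne_zero
  obtain ⟨h, hh, hh0, hle⟩ := hd' g (hGI g hg) hg0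
  obtain ⟨k, hk, hk0, hle2⟩ := hd h (hGI' h hh) hh0
  have hkg : k = g := by
    by_contra hne
    exact hGr g hg k hk hne _ ((lexOrder n).degree_mem_support hg0) (hle2.trans hle)
  rw [hkg] at hle2
  have hdeg : (lexOrder n).degree h = (lexOrder n).degree g := le_antisymm hle hle2
  by_cases hgh : g - h = 0
  · rw [sub_eq_zero.mp hgh]
    exact hh
  exfalso
  have hmem : g - h ∈ I := sub_mem (hGI g hg) (hGI' h hh)
  have hcoeff : (g - h).coeff ((lexOrder n).degree g) = 0 := by
    have h1 := hGm g hg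
    have h2 := hGm' h hh
    rw [MonomialOrder.Monic, MonomialOrder.leadingCoeff] at h1 h2
    rw [coeff_sub, h1, ← hdeg, h2, sub_self]
  have hsup := (lexOrder n).degree_mem_support hgh
  have hlt : (lexOrder n).degree (g - h) ≺[lexOrder n] (lexOrder n).degree g := by
    refine lt_of_le_of_ne ?_ ?_
    · refine ((lexOrder n).degree_sub_le).trans ?_
      rw [hdeg, sup_idem]
    · intro he
      rw [(lexOrder n).toSyn.injective he, mem_support_iff] at hsup
      exact hsup hcoeff
  obtain ⟨p, hp, hp0, hple⟩ := hd _ hmem hgh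
  obtain ⟨p', hp', hp0', hple'⟩ := hd' _ hmem hgh
  rcases Finset.mem_union.mp (support_sub (Fin n) g h hsup) with hs | hs
  · by_cases hpg : p = g
    · rw [hpg] at hple
      exact absurd ((lexOrder n).toSyn_monotone hple) (not_le.mpr hlt)
    · exact hGr g hg p hp hpg _ hs hple
  · by_cases hph : p' = h
    · rw [hph, hdeg] at hple'
      exact absurd ((lexOrder n).toSyn_monotone hple') (not_le.mpr hlt)
    · exact hGr' h hh p' hp' hph _ hs hple'

theorem existsUnique_isReducedGroebnerBasis (I : Ideal (MvPolynomial (Fin n) K)) :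
    ∃! G, IsReducedGroebnerBasis G I := by
  obtain ⟨G, hG⟩ := exists_isReducedGroebnerBasis I
  exact ⟨G, hG, fun G' hG' => (hG'.subset hG).antisymm (hG.subset hG')⟩

end ExistenceUniqueness

/-- The reduced lexicographical Gröbner basis of `I`. -/
noncomputable def groebnerBasis (I : Ideal (MvPolynomial (Fin n) K)) :
    Finset (MvPolynomial (Fin n) K) :=
  (existsUnique_isReducedGroebnerBasis I).exists.choose

open Classical in
/-- The W-characteristic set of `I`: for each possible value of the leading variable (constants
included), the smallest polynomial with that leading variable in the reduced lexicographical
Gröbner basis of `I`, if there is one. Distinct elements of that basis have distinct leading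
terms, so smallest means having the smallest leading term. -/
noncomputable def wChar (I : Ideal (MvPolynomial (Fin n) K)) :
    Finset (MvPolynomial (Fin n) K) :=
  (groebnerBasis I).filter (fun F => ∀ H ∈ groebnerBasis I, lv H = lv F →
    (lexOrder n).degree F ≼[lexOrder n] (lexOrder n).degree H)

/-- `(G, C)` is a characteristic pair: `G` is a reduced lexicographical Gröbner basis and `C` is
the W-characteristic set of `⟨G⟩`. -/
def IsCharacteristicPair (G C : Finset (MvPolynomial (Fin n) K)) : Prop :=
  IsReducedGroebnerBasis G (Ideal.span (G : Set (MvPolynomial (Fin n) K))) ∧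
    C = wChar (Ideal.span (G : Set (MvPolynomial (Fin n) K)))

/-- A strong regular characteristic pair: `sat C = ⟨G⟩` and `C` is regular, where the trivial pair
`({1}, {1})` counts as regular. -/
def IsStrongRegularPair (G C : Finset (MvPolynomial (Fin n) K)) : Prop :=
  IsCharacteristicPair G C ∧
    sat C = Ideal.span (G : Set (MvPolynomial (Fin n) K)) ∧
    (IsRegularSet C ∨ (G = {1} ∧ C = {1}))

end Definitions

end StrongRegularization

namespace StrongRegularization

section Proof

variable {n : ℕ} {K : Type*} [Field K]

/-! Every ideal `J` lies in `sat (wChar J)`. For proper `J` and nonzero `P ∈ J`, the leading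
monomial of `P` is divisible by that of some `g` in the reduced Gröbner basis. The element `F` of
`wChar J` with the same leading variable `x_i` has degree in `x_i` at most that of `g`, so one
pseudo-division step by `F` applies. It yields an element of `J` with smaller leading monomial, and
the induction ends at zero (`exists_pseudo_reduction`, `mem_sat_of_wChar_lv_le`). Hence the ideals
`sat (C i)` form an ascending chain, which stabilizes because the polynomial ring is Noetherian.

At a stable point the ideal satisfies `J = sat (wChar J)`. If `J` is proper, initials of `wChar J`
can be cancelled modulo `J`. Regularity asks for cancellation modulo `sat T`, where `T` holds the
elements of `wChar J` with leading variable below `x_i`. A colon computation in the variables below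
`x_i` (`mem_span_of_mul_mem_span_supported`) reduces this to elements of `J` in these variables, and
their pseudo-reduction uses only members of `T`. If `J` is the unit ideal, the trivial pair appears.
-/

/-! ### Leading variables, initials and pseudo-division -/

theorem lv_le_iff_mem_supported {F : MvPolynomial (Fin n) K} {w : WithBot (Fin n)} :
    lv F ≤ w ↔ F ∈ supported K {k : Fin n | (k : WithBot (Fin n)) ≤ w} := by
  rw [mem_supported, lv, Finset.max_le_iff]
  rfl

theorem lv_lt_coe_iff_mem_supported {F : MvPolynomial (Fin n) K} {i : Fin n} :
    lv F < i ↔ F ∈ supported K (Set.Iio i) := by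
  rw [mem_supported, lv, Finset.max_eq_sup_withBot, Finset.sup_lt_iff (WithBot.bot_lt_coe i)]
  simp [Set.subset_def]

theorem eq_zero_of_mem_supported {F : MvPolynomial (Fin n) K} {s : Set (Fin n)}
    (hF : F ∈ supported K s) {a : Fin n →₀ ℕ} (ha : a ∈ F.support) {k : Fin n} (hk : k ∉ s) :
    a k = 0 := by
  by_contra h
  exact hk (mem_supported.mp hF
    ((mem_vars_iff_mem_support k).mpr ⟨a, ha, Finsupp.mem_support_iff.mpr h⟩))

theorem monomial_mem_supported {s : Set (Fin n)} {a : Fin n →₀ ℕ} (c : K)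
    (h : ∀ k, a k ≠ 0 → k ∈ s) : monomial a c ∈ supported K s := by
  rw [mem_supported]
  intro k hk
  obtain ⟨b, hb, hkb⟩ := (mem_vars_iff_mem_support k).mp hk
  rw [Finset.mem_singleton.mp (support_monomial_subset hb)] at hkb
  exact h k (Finsupp.mem_support_iff.mp hkb)

theorem eq_zero_of_lv_eq {F : MvPolynomial (Fin n) K} {i : Fin n} (hF : lv F = i)
    {a : Fin n →₀ ℕ} (ha : a ∈ F.support) {k : Fin n} (hk : i < k) : a k = 0 :=
  eq_zero_of_mem_supported (lv_le_iff_mem_supported.mp hF.le) ha (by simpa using hk)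

/-- No variable above `x_i` occurs, so the lexicographic comparison is decided by the exponent of
`x_i` whenever these differ. -/
theorem degree_apply_of_lv_eq {F : MvPolynomial (Fin n) K} {i : Fin n} (hF : lv F = i) :
    (lexOrder n).degree F i = F.degreeOf i := by
  have h0 : F ≠ 0 := by
    rintro rfl
    simp [lv] at hF
  have hm := (lexOrder n).degree_mem_support h0
  rw [degreeOf_eq_sup]
  apply le_antisymm (Finset.le_sup (f := fun m : Fin n →₀ ℕ => m i) hm)
  refine Finset.sup_le fun b hb => ?_
  by_contra! h
  refine absurd ((lexOrder n).le_degree hb) (not_le.mpr ?_)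
  rw [lexOrder_lt_iff]
  exact ⟨i, fun j hj => by rw [eq_zero_of_lv_eq hF hb hj, eq_zero_of_lv_eq hF hm hj], h⟩

/-- The degree in the leading variable is monotone along the lexicographic order. -/
theorem degree_apply_le_of_lv_eq {F H : MvPolynomial (Fin n) K} {i : Fin n} (hF : lv F = i)
    (hH : lv H = i) (hle : (lexOrder n).degree F ≼[lexOrder n] (lexOrder n).degree H) :
    (lexOrder n).degree F i ≤ (lexOrder n).degree H i := by
  have hm : ∀ {P : MvPolynomial (Fin n) K}, lv P = i → (lexOrder n).degree P ∈ P.support := by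
    intro P hP
    refine (lexOrder n).degree_mem_support ?_
    rintro rfl
    simp [lv] at hP
  by_contra! h
  refine absurd hle (not_le.mpr ?_)
  rw [lexOrder_lt_iff]
  exact ⟨i, fun j hj => by
    rw [eq_zero_of_lv_eq hF (hm hF) hj, eq_zero_of_lv_eq hH (hm hH) hj], h⟩

theorem ini_eq_sum {F : MvPolynomial (Fin n) K} {i : Fin n} (hF : lv F = i) :
    ini F = ∑ a ∈ F.support.filter (fun a => a i = F.degreeOf i),
      monomial (a.erase i) (F.coeff a) := by
  simp only [ini, hF]

theorem ini_mem_supported {F : MvPolynomial (Fin n) K} {i : Fin n} (hF : lv F = i) :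
    ini F ∈ supported K (Set.Iio i) := by
  rw [ini_eq_sum hF]
  refine Subalgebra.sum_mem _ fun a ha => monomial_mem_supported _ fun k hk => ?_
  have ha' := (Finset.mem_filter.mp ha).1
  by_contra hki
  rcases eq_or_lt_of_le (not_lt.mp (Set.mem_Iio.not.mp hki)) with rfl | hlt
  · simp at hk
  · rw [Finsupp.erase_ne hlt.ne', eq_zero_of_lv_eq hF ha' hlt] at hk
    exact hk rfl

/-- A polynomial is its initial times the top power of its leading variable, plus terms of lower
degree in the leading variable. -/
theorem exists_eq_ini_mul_add {F : MvPolynomial (Fin n) K} {i : Fin n} (hF : lv F = i) :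
    ∃ T : MvPolynomial (Fin n) K, F = ini F * X i ^ F.degreeOf i + T ∧
      ∀ a ∈ T.support, a i < F.degreeOf i ∧ ∀ k, i < k → a k = 0 := by
  classical
  refine ⟨∑ a ∈ F.support.filter (fun a => ¬ a i = F.degreeOf i), monomial a (F.coeff a),
    ?_, ?_⟩
  · conv_lhs => rw [F.as_sum, ← Finset.sum_filter_add_sum_filter_not F.support
      (fun a => a i = F.degreeOf i)]
    rw [ini_eq_sum hF, Finset.sum_mul]
    congr 1
    refine Finset.sum_congr rfl fun a ha => ?_
    rw [X_pow_eq_monomial, monomial_mul, mul_one, ← (Finset.mem_filter.mp ha).2,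
      Finsupp.erase_add_single]
  · intro a ha
    obtain ⟨b, hb, hab⟩ := Finset.mem_biUnion.mp (support_sum ha)
    obtain rfl := Finset.mem_singleton.mp (support_monomial_subset hab)
    obtain ⟨hb1, hb2⟩ := Finset.mem_filter.mp hb
    refine ⟨lt_of_le_of_ne ?_ hb2, fun k hk => eq_zero_of_lv_eq hF hb1 hk⟩
    rw [degreeOf_eq_sup]
    exact Finset.le_sup (f := fun m : Fin n →₀ ℕ => m i) hb1

/-- One step of pseudo-division: multiplying `P` by the initial of `F` and subtracting a multiple
of `F` lowers the leading monomial of `P`, if this monomial is not reduced with respect to `F`. -/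
theorem exists_pseudo_reduction {F P : MvPolynomial (Fin n) K} {i : Fin n} (hF : lv F = i)
    (hd : F.degreeOf i ≤ (lexOrder n).degree P i) :
    ∃ Q : MvPolynomial (Fin n) K, (∀ w, lv P ≤ w → lv Q ≤ w) ∧
      ∀ b ∈ (ini F * P - Q * F).support, b ≺[lexOrder n] (lexOrder n).degree P := by
  classical
  set a := (lexOrder n).degree P with ha
  set d := F.degreeOf i with hd'
  obtain ⟨T, hT, hTs⟩ := exists_eq_ini_mul_add hF
  -- `Q` takes all terms of `P` agreeing with the leading monomial from `x_i` upwards, not only the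
  -- leading one: `ini F` need not be a monomial, and its product with any of these terms may exceed
  -- `a`. The terms left in `R` are already below `a` because of a variable `x_k` with `i ≤ k`,
  -- which `ini F` does not involve.
  set s := P.support.filter (fun b => ∀ k, i ≤ k → b k = a k) with hs
  set t := P.support.filter (fun b => ¬ ∀ k, i ≤ k → b k = a k) with ht
  set Q : MvPolynomial (Fin n) K := ∑ b ∈ s, monomial (b - Finsupp.single i d) (P.coeff b) with hQ
  set R : MvPolynomial (Fin n) K := ∑ b ∈ t, monomial b (P.coeff b) with hR
  have hPQR : P = Q * X i ^ d + R := by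
    conv_lhs => rw [P.as_sum, ← Finset.sum_filter_add_sum_filter_not P.support
      (fun b => ∀ k, i ≤ k → b k = a k)]
    rw [hQ, Finset.sum_mul]
    congr 1
    refine Finset.sum_congr rfl fun b hb => ?_
    have hbi := (Finset.mem_filter.mp hb).2 i le_rfl
    rw [X_pow_eq_monomial, monomial_mul, mul_one, tsub_add_cancel_of_le]
    rw [Finsupp.single_le_iff, hbi]
    exact hd
  refine ⟨Q, fun w hw => ?_, ?_⟩
  · rw [lv_le_iff_mem_supported] at hw ⊢
    refine Subalgebra.sum_mem _ fun b hb => monomial_mem_supported _ fun k hk => ?_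
    by_contra hkw
    have := eq_zero_of_mem_supported hw (Finset.mem_filter.mp hb).1 hkw
    simp [this] at hk
  · have heq : ini F * P - Q * F = ini F * R - Q * T := by
      conv_lhs => rw [hPQR]
      have : Q * F = Q * (ini F * X i ^ d + T) := by rw [← hT]
      rw [this]
      ring
    intro b hb
    rw [heq] at hb
    rcases Finset.mem_union.mp (support_sub (Fin n) _ _ hb) with h | h
    · obtain ⟨c, hc, e, he, rfl⟩ := Finset.mem_add.mp (support_mul _ _ h)
      obtain ⟨e', he', hee⟩ := Finset.mem_biUnion.mp (support_sum he)
      obtain rfl := Finset.mem_singleton.mp (support_monomial_subset hee)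
      obtain ⟨heP, hne⟩ := Finset.mem_filter.mp he'
      have hlt : e ≺[lexOrder n] a := by
        refine lt_of_le_of_ne ((lexOrder n).le_degree heP) fun h => hne ?_
        rw [(lexOrder n).toSyn.injective h]
        simp
      rw [lexOrder_lt_iff] at hlt ⊢
      obtain ⟨k, hk, hkl⟩ := hlt
      have hik : i ≤ k := by
        by_contra! hki
        exact hne fun l hl => hk l (hki.trans_le hl)
      have hc0 : ∀ l, i ≤ l → c l = 0 := fun l hl =>
        eq_zero_of_mem_supported (ini_mem_supported hF) hc (by simpa using hl)
      exact ⟨k, fun l hl => by simp [hc0 l (hik.trans hl.le), hk l hl],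
        by simpa [hc0 k hik] using hkl⟩
    · obtain ⟨c, hc, e, he, rfl⟩ := Finset.mem_add.mp (support_mul _ _ h)
      obtain ⟨c', hc', hcc⟩ := Finset.mem_biUnion.mp (support_sum hc)
      obtain rfl := Finset.mem_singleton.mp (support_monomial_subset hcc)
      obtain ⟨hcP, hce⟩ := Finset.mem_filter.mp hc'
      obtain ⟨he1, he2⟩ := hTs e he
      rw [lexOrder_lt_iff]
      refine ⟨i, fun l hl => ?_, ?_⟩
      · simp [he2 l hl, hce l hl.le, hl.ne]
      · have := hce i le_rfl
        simp only [Finsupp.coe_add, Finsupp.coe_tsub, Pi.add_apply, Pi.sub_apply,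
          Finsupp.single_eq_same, this]
        omega

/-! ### Reduced Gröbner bases and W-characteristic sets -/

theorem groebnerBasis_spec (I : Ideal (MvPolynomial (Fin n) K)) :
    IsReducedGroebnerBasis (groebnerBasis I) I :=
  (existsUnique_isReducedGroebnerBasis I).exists.choose_spec

theorem IsReducedGroebnerBasis.eq_groebnerBasis {G : Finset (MvPolynomial (Fin n) K)}
    {I : Ideal (MvPolynomial (Fin n) K)} (hG : IsReducedGroebnerBasis G I) :
    G = groebnerBasis I :=
  (existsUnique_isReducedGroebnerBasis I).unique hG (groebnerBasis_spec I)

theorem exists_mem_groebnerBasis_degree_le {I : Ideal (MvPolynomial (Fin n) K)}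
    {P : MvPolynomial (Fin n) K} (hP : P ∈ I) (h0 : P ≠ 0) :
    ∃ g ∈ groebnerBasis I, g ≠ 0 ∧ (lexOrder n).degree g ≤ (lexOrder n).degree P :=
  (span_leadingTerm_le_iff _ _).mp (groebnerBasis_spec I).1.2.ge P hP h0

/-- The remainder of `P ∈ I` on division by the basis lies in `I`, yet none of its terms is
divisible by a leading monomial of the basis, so it vanishes. -/
theorem span_groebnerBasis (I : Ideal (MvPolynomial (Fin n) K)) :
    Ideal.span (groebnerBasis I : Set (MvPolynomial (Fin n) K)) = I := by
  have hspec := groebnerBasis_spec I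
  apply le_antisymm (Ideal.span_le.mpr hspec.1.1)
  intro P hP
  obtain ⟨q, r, hqr, -, hr⟩ := (lexOrder n).div_set
    (B := (groebnerBasis I : Set (MvPolynomial (Fin n) K)))
    (fun b hb => by simpa using (hspec.2.1 b hb).ne_zero) P
  have hmem : (Finsupp.linearCombination (MvPolynomial (Fin n) K)
      fun b : (groebnerBasis I : Set (MvPolynomial (Fin n) K)) => (b : MvPolynomial (Fin n) K)) q ∈
      Ideal.span (groebnerBasis I : Set (MvPolynomial (Fin n) K)) := by
    rw [Finsupp.linearCombination_apply]
    exact Submodule.sum_mem _ fun b _ => Ideal.mul_mem_left _ _ (Ideal.subset_span b.2)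
  have hrI : r ∈ I := by
    have : r = P - (P - r) := by ring
    rw [this]
    refine sub_mem hP ?_
    rw [hqr, add_sub_cancel_right]
    exact Ideal.span_le.mpr hspec.1.1 hmem
  have hr0 : r = 0 := by
    by_contra h0
    obtain ⟨g, hg, -, hle⟩ := exists_mem_groebnerBasis_degree_le hrI h0
    exact hr _ ((lexOrder n).degree_mem_support h0) g hg hle
  rw [hqr, hr0, add_zero]
  exact hmem

theorem wChar_subset (I : Ideal (MvPolynomial (Fin n) K)) : wChar I ⊆ groebnerBasis I := by
  classical
  exact Finset.filter_subset _ _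

theorem mem_of_mem_wChar {I : Ideal (MvPolynomial (Fin n) K)} {F : MvPolynomial (Fin n) K}
    (hF : F ∈ wChar I) : F ∈ I :=
  (groebnerBasis_spec I).1.1 F (wChar_subset I hF)

theorem exists_mem_wChar_lv_eq {I : Ideal (MvPolynomial (Fin n) K)} {g : MvPolynomial (Fin n) K}
    (hg : g ∈ groebnerBasis I) : ∃ F ∈ wChar I, lv F = lv g ∧
      (lexOrder n).degree F ≼[lexOrder n] (lexOrder n).degree g := by
  classical
  obtain ⟨F, hF, hmin⟩ := Finset.exists_min_image ((groebnerBasis I).filter fun H => lv H = lv g)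
    (fun H => (lexOrder n).toSyn ((lexOrder n).degree H))
    ⟨g, Finset.mem_filter.mpr ⟨hg, rfl⟩⟩
  obtain ⟨hFG, hFlv⟩ := Finset.mem_filter.mp hF
  refine ⟨F, Finset.mem_filter.mpr ⟨hFG, fun H hH hlv => ?_⟩, hFlv,
    hmin g (Finset.mem_filter.mpr ⟨hg, rfl⟩)⟩
  exact hmin H (Finset.mem_filter.mpr ⟨hH, hlv.trans hFlv⟩)

theorem eq_top_of_lv_eq_bot {I : Ideal (MvPolynomial (Fin n) K)} {F : MvPolynomial (Fin n) K}
    (hF : F ∈ I) (h0 : F ≠ 0) (hlv : lv F = ⊥) : I = ⊤ := by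
  have hC : F = C (F.coeff 0) := vars_eq_empty_iff_eq_C.mp (Finset.max_eq_bot.mp hlv)
  refine Ideal.eq_top_of_isUnit_mem I hF ?_
  rw [hC]
  refine (IsUnit.mk0 _ fun h => h0 ?_).map C
  rw [hC, h, map_zero]

/-- Two members with the same leading variable are both minimal, hence have equal leading monomials,
which reducedness forbids for distinct elements. Properness excludes constants. -/
theorem isTriangularSet_wChar {I : Ideal (MvPolynomial (Fin n) K)} (hI : I ≠ ⊤) :
    IsTriangularSet (wChar I) := by
  classical
  have hspec := groebnerBasis_spec I
  refine ⟨fun F hF hlv => hI (eq_top_of_lv_eq_bot (mem_of_mem_wChar hF)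
    (hspec.2.1 F (wChar_subset I hF)).ne_zero hlv), ?_⟩
  intro F hF H hH hlv
  obtain ⟨hFG, hFmin⟩ := Finset.mem_filter.mp hF
  obtain ⟨hHG, hHmin⟩ := Finset.mem_filter.mp hH
  have hdeg : (lexOrder n).degree F = (lexOrder n).degree H :=
    (lexOrder n).toSyn.injective (le_antisymm (hFmin H hHG hlv.symm) (hHmin F hFG hlv))
  by_contra hne
  exact hspec.2.2 H hHG F hFG hne _
    ((lexOrder n).degree_mem_support (hspec.2.1 H hHG).ne_zero) hdeg.le

/-! ### Saturated ideals and pseudo-reduction to zero -/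

theorem span_le_sat (T : Finset (MvPolynomial (Fin n) K)) :
    Ideal.span (T : Set (MvPolynomial (Fin n) K)) ≤ sat T :=
  fun P hP => ⟨0, by simpa using hP⟩

theorem mem_sat_of_mul_prod_mem {T : Finset (MvPolynomial (Fin n) K)}
    {P : MvPolynomial (Fin n) K} (h : P * ∏ F ∈ T, ini F ∈ sat T) : P ∈ sat T := by
  obtain ⟨i, hi⟩ := h
  exact ⟨i + 1, by rwa [pow_succ', ← mul_assoc]⟩

/-- `ini F` divides the product of initials. This undoes the factor `ini F` that a pseudo-division
step introduces. -/
theorem mem_sat_of_mul_ini_mem {T : Finset (MvPolynomial (Fin n) K)}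
    {F P : MvPolynomial (Fin n) K} (hF : F ∈ T) (h : P * ini F ∈ sat T) : P ∈ sat T := by
  classical
  apply mem_sat_of_mul_prod_mem
  rw [← Finset.mul_prod_erase T ini hF, ← mul_assoc]
  exact Ideal.mul_mem_right _ _ h

theorem sat_mono {S T : Finset (MvPolynomial (Fin n) K)} (h : S ⊆ T) : sat S ≤ sat T := by
  classical
  rintro P ⟨i, hi⟩
  refine ⟨i, ?_⟩
  rw [← Finset.prod_sdiff h, mul_pow, mul_left_comm]
  exact Ideal.mul_mem_left _ _ (Ideal.span_mono (by exact_mod_cast h) hi)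

/-- Elements of a proper ideal pseudo-reduce to zero modulo the elements of its W-characteristic
set whose leading variables are not greater. -/
theorem mem_sat_of_wChar_lv_le {I : Ideal (MvPolynomial (Fin n) K)} (hI : I ≠ ⊤)
    {T : Finset (MvPolynomial (Fin n) K)} {w : WithBot (Fin n)}
    (hT : ∀ F ∈ wChar I, lv F ≤ w → F ∈ T) (P : MvPolynomial (Fin n) K) (hP : P ∈ I)
    (hw : lv P ≤ w) : P ∈ sat T := by
  have := (lexOrder n).wellFoundedLT_syn
  induction hs : (lexOrder n).toSyn ((lexOrder n).degree P) using WellFoundedLT.induction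
    generalizing P with
  | ind a IH =>
  subst hs
  by_cases h0 : P = 0
  · exact h0 ▸ zero_mem _
  obtain ⟨g, hg, hg0, hle⟩ := exists_mem_groebnerBasis_degree_le hP h0
  have hgI := (groebnerBasis_spec I).1.1 g hg
  obtain ⟨F, hF, hlv, hdeg⟩ := exists_mem_wChar_lv_eq hg
  have hlvF : lv F ≠ ⊥ := (isTriangularSet_wChar hI).1 F hF
  obtain ⟨i, hi⟩ := WithBot.ne_bot_iff_exists.mp hlvF
  have hgi : lv g = i := by rw [← hlv, hi]
  have hdegi : F.degreeOf i ≤ (lexOrder n).degree g i := by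
    rw [← degree_apply_of_lv_eq hi.symm]
    exact degree_apply_le_of_lv_eq hi.symm hgi hdeg
  -- Since `x_i` occurs in the leading monomial of `g`, it occurs in `P`. This gives `x_i ≤ w`, and
  -- so `F` belongs to `T`.
  have hgpos : (lexOrder n).degree g i ≠ 0 := by
    rw [degree_apply_of_lv_eq hgi]
    have : i ∈ g.vars := Finset.mem_of_max hgi
    rw [mem_vars_iff_mem_support] at this
    obtain ⟨b, hb, hib⟩ := this
    rw [degreeOf_eq_sup]
    have h1 := Finset.le_sup (f := fun m : Fin n →₀ ℕ => m i) hb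
    have h2 := Finsupp.mem_support_iff.mp hib
    omega
  have hiw : (i : WithBot (Fin n)) ≤ w := by
    by_contra hiw
    have := eq_zero_of_mem_supported (lv_le_iff_mem_supported.mp hw)
      ((lexOrder n).degree_mem_support h0) (k := i) hiw
    have := hle i
    omega
  have hFT : F ∈ T := hT F hF (hi ▸ hiw)
  obtain ⟨Q, hQ, hlt⟩ := exists_pseudo_reduction hi.symm (hdegi.trans (hle i))
  have hlow : ini F * P - Q * F ∈ sat T := by
    by_cases hz : ini F * P - Q * F = 0
    · exact hz ▸ zero_mem _
    refine IH _ (hlt _ ((lexOrder n).degree_mem_support hz)) _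
      (sub_mem (Ideal.mul_mem_left _ _ hP) (Ideal.mul_mem_left _ _ (mem_of_mem_wChar hF))) ?_ rfl
    -- The induction also needs the pseudo-remainder to stay within the variables bounded by `w`.
    have hQw := hQ w hw
    rw [lv_le_iff_mem_supported] at hw hQw ⊢
    refine sub_mem (mul_mem (supported_mono ?_ (ini_mem_supported hi.symm)) hw)
      (mul_mem hQw (lv_le_iff_mem_supported.mp (hi ▸ hiw)))
    intro k hk
    exact (WithBot.coe_le_coe.mpr (le_of_lt hk)).trans hiw
  refine mem_sat_of_mul_ini_mem hFT ?_
  have h1 := add_mem hlow (Ideal.mul_mem_left _ Q (span_le_sat T (Ideal.subset_span hFT)))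
  rwa [sub_add_cancel, mul_comm] at h1

/-! ### The unit ideal and the inclusion into the saturation -/

theorem groebnerBasis_top : groebnerBasis (⊤ : Ideal (MvPolynomial (Fin n) K)) = {1} := by
  refine (IsReducedGroebnerBasis.eq_groebnerBasis ⟨⟨by simp, ?_⟩, ?_, ?_⟩).symm
  · apply le_antisymm (Ideal.span_mono (Set.image_mono (by simp)))
    rw [span_leadingTerm_le_iff]
    intro f _ _
    exact ⟨1, by simp, one_ne_zero, by simp⟩
  · simp [MonomialOrder.Monic, MonomialOrder.leadingCoeff]
  · simp

theorem wChar_top : wChar (⊤ : Ideal (MvPolynomial (Fin n) K)) = {1} := by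
  classical
  simp [wChar, groebnerBasis_top]

theorem sat_singleton_one : sat ({1} : Finset (MvPolynomial (Fin n) K)) = ⊤ :=
  (Ideal.eq_top_iff_one _).mpr (span_le_sat _ (Ideal.subset_span (by simp)))

theorem le_sat_wChar (I : Ideal (MvPolynomial (Fin n) K)) : I ≤ sat (wChar I) := by
  by_cases hI : I = ⊤
  · rw [hI, wChar_top, sat_singleton_one]
  · exact fun P hP => mem_sat_of_wChar_lv_le hI (fun F hF _ => hF) P hP le_rfl

/-! ### Regularity at a fixed point -/

/-- A colon ideal of an ideal generated by polynomials in some of the variables, by a polynomial in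
these variables, is again generated by polynomials in these variables. -/
theorem mem_span_of_mul_mem_span_supported {s : Set (Fin n)} {S : Set (MvPolynomial (Fin n) K)}
    (hS : ∀ f ∈ S, f ∈ supported K s) {u q : MvPolynomial (Fin n) K} (hu : u ∈ supported K s)
    (h : q * u ∈ Ideal.span S) :
    q ∈ Ideal.span {r | r ∈ supported K s ∧ r * u ∈ Ideal.span S} := by
  classical
  rw [supported_eq_range_rename] at hS hu
  let ι : MvPolynomial s K →+* MvPolynomial (Fin n) K :=
    (rename (Subtype.val : s → Fin n) : MvPolynomial s K →ₐ[K] MvPolynomial (Fin n) K)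
  -- `Φ` moves the variables in `s` into the coefficients, and `Ψ` moves them back. The outer
  -- variables remain indexed by all of `Fin n`, so `Φ` need not be surjective; only `Ψ ∘ Φ = id` is
  -- used.
  let Φ : MvPolynomial (Fin n) K →+* MvPolynomial (Fin n) (MvPolynomial s K) :=
    eval₂Hom (C.comp C) fun k => if hk : k ∈ s then C (X ⟨k, hk⟩) else X k
  let Ψ : MvPolynomial (Fin n) (MvPolynomial s K) →+* MvPolynomial (Fin n) K := eval₂Hom ι X
  have hΦι : ∀ p, Φ (ι p) = C p := by
    intro p
    have : Φ.comp ι = C := by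
      ext k : 2
      · simp [Φ, ι]
      · simp [Φ, ι]
    exact congrArg (fun φ => φ p) this
  have hΨΦ : Ψ (Φ q) = q := by
    have : Ψ.comp Φ = RingHom.id _ := by
      ext k : 2
      · simp [Φ, Ψ, ι]
      · by_cases hk : k ∈ s <;> simp [Φ, Ψ, ι, hk]
    exact congrArg (fun φ => φ q) this
  obtain ⟨v, rfl⟩ := hu
  let S' : Set (MvPolynomial s K) := ι ⁻¹' S
  have hSS : S = ι '' S' := by
    rw [Set.image_preimage_eq_of_subset]
    intro f hf
    obtain ⟨p, hp⟩ := hS f hf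
    exact ⟨p, hp⟩
  have hmap : Ideal.map Φ (Ideal.span S) = Ideal.map C (Ideal.span S') := by
    rw [hSS, Ideal.map_span, Ideal.map_span, Set.image_image]
    congr 1
    exact Set.image_congr fun p _ => hΦι p
  have hΦ : Φ q * C v ∈ Ideal.map C (Ideal.span S') := by
    rw [← hmap, ← hΦι v, ← map_mul]
    exact Ideal.mem_map_of_mem Φ h
  -- Membership in an extended ideal is tested coefficientwise, and multiplication by the constant
  -- `v` acts on each coefficient. So every coefficient of `Φ q` lies in the colon ideal over the
  -- smaller ring.
  rw [mem_map_C_iff] at hΦ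
  rw [← hΨΦ, (Φ q).as_sum, map_sum]
  refine Submodule.sum_mem _ fun m _ => ?_
  have hm : Ψ (monomial m (coeff m (Φ q))) = ι (coeff m (Φ q)) * monomial m 1 := by
    rw [← mul_one (coeff m (Φ q)), ← C_mul_monomial, map_mul]
    simp [Ψ, monomial_eq]
  rw [hm]
  refine Ideal.mul_mem_right _ _ (Ideal.subset_span ⟨?_, ?_⟩)
  · rw [supported_eq_range_rename]
    exact ⟨_, rfl⟩
  · have h1 := hΦ m
    rw [mul_comm, coeff_C_mul, mul_comm] at h1
    have h2 := Ideal.mem_map_of_mem ι h1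
    rw [Ideal.map_span, ← hSS, map_mul] at h2
    exact h2

/-- If a proper ideal is the saturated ideal of its W-characteristic set, then this set is
regular. -/
theorem isRegularSet_wChar {I : Ideal (MvPolynomial (Fin n) K)} (hI : I ≠ ⊤)
    (hsat : sat (wChar I) = I) : IsRegularSet (wChar I) := by
  classical
  have htri := isTriangularSet_wChar hI
  refine ⟨htri, fun F hF => ?_⟩
  obtain ⟨i, hi⟩ := WithBot.ne_bot_iff_exists.mp (htri.1 F hF)
  set T := (wChar I).filter (fun P => lv P < lv F) with hT
  have hTC : T ⊆ wChar I := Finset.filter_subset _ _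
  have hTI : sat T ≤ I := hsat ▸ sat_mono hTC
  have hcancel : ∀ q, q * ini F ∈ I → q ∈ I := by
    intro q hq
    rw [← hsat] at hq ⊢
    exact mem_sat_of_mul_ini_mem hF hq
  have hTs : ∀ f ∈ T, f ∈ supported K (Set.Iio i) := fun f hf =>
    lv_lt_coe_iff_mem_supported.mp (hi ▸ (Finset.mem_filter.mp hf).2)
  have hTini : ∀ f ∈ T, ini f ∈ supported K (Set.Iio i) := by
    intro f hf
    obtain ⟨k, hk⟩ := WithBot.ne_bot_iff_exists.mp (htri.1 f (hTC hf))
    refine supported_mono (Set.Iio_subset_Iio ?_) (ini_mem_supported hk.symm)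
    have := (Finset.mem_filter.mp hf).2
    rw [← hi, ← hk] at this
    exact (WithBot.coe_lt_coe.mp this).le
  refine ⟨fun h0 => hI ?_, ?_⟩
  · rw [Ideal.Quotient.eq_zero_iff_mem] at h0
    rw [Ideal.eq_top_iff_one]
    exact hcancel 1 (by simpa using hTI h0)
  · rw [mem_nonZeroDivisors_iff_right]
    intro x hx
    obtain ⟨q, rfl⟩ := Ideal.Quotient.mk_surjective x
    rw [← map_mul, Ideal.Quotient.eq_zero_iff_mem] at hx
    rw [Ideal.Quotient.eq_zero_iff_mem]
    obtain ⟨t, ht⟩ := hx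
    rw [mul_assoc] at ht
    have hu : ini F * (∏ f ∈ T, ini f) ^ t ∈ supported K (Set.Iio i) :=
      mul_mem (ini_mem_supported hi.symm) (pow_mem (prod_mem hTini) t)
    -- `q` may involve variables from `x_i` upwards, but the generators of `⟨T⟩` and the multiplier
    -- do not, so it suffices to treat `r` in the variables below `x_i`.
    refine Ideal.span_le.mpr ?_ (mem_span_of_mul_mem_span_supported hTs hu ht)
    rintro r ⟨hr, hrT⟩
    rw [← mul_assoc] at hrT
    have hlt := lv_lt_coe_iff_mem_supported.mpr hr
    -- Here `r ∈ I` by cancelling `ini F`. With the bound `w = lv r < lv F`, every element used in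
    -- its pseudo-reduction is in `T`.
    refine mem_sat_of_wChar_lv_le hI (fun H hH hle => ?_) r
      (hcancel r (hTI ⟨t, hrT⟩)) le_rfl
    exact Finset.mem_filter.mpr ⟨hH, hi ▸ hle.trans_lt hlt⟩

end Proof

end StrongRegularization

/-! ### Stabilization of the chain of saturated ideals -/

theorem theorem3p3 {n : ℕ} {K : Type*} [Field K] [CharZero K]
    (I : Ideal (MvPolynomial (Fin n) K))
    (C G : ℕ → Finset (MvPolynomial (Fin n) K))
    (hC₁ : C 1 = StrongRegularization.wChar I)
    (hG : ∀ i, 2 ≤ i →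
      G i = StrongRegularization.groebnerBasis (StrongRegularization.sat (C (i - 1))))
    (hC : ∀ i, 2 ≤ i →
      C i = StrongRegularization.wChar (Ideal.span (G i : Set (MvPolynomial (Fin n) K)))) :
    ∃ m, 2 ≤ m ∧
      I ≤ StrongRegularization.sat (C 1) ∧
      StrongRegularization.sat (C 1) ≤ StrongRegularization.sat (C m) ∧
      (StrongRegularization.IsRegularSet (C m) ∨ StrongRegularization.sat (C m) = ⊤) ∧
      StrongRegularization.IsStrongRegularPair (G m) (C m) := by
  open StrongRegularization in
  have hspan : ∀ i, Ideal.span (G (i + 2) : Set (MvPolynomial (Fin n) K)) = sat (C (i + 1)) := by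
    intro i
    rw [hG (i + 2) (by omega)]
    exact span_groebnerBasis _
  have hCs : ∀ i, C (i + 2) = wChar (sat (C (i + 1))) := fun i => by
    rw [hC (i + 2) (by omega), hspan]
  have hmono : Monotone fun i => sat (C (i + 1)) := monotone_nat_of_le_succ fun i => by
    rw [hCs i]
    exact le_sat_wChar _
  obtain ⟨N, hN⟩ := monotone_stabilizes_iff_noetherian.mpr
    (inferInstanceAs (IsNoetherian (MvPolynomial (Fin n) K) (MvPolynomial (Fin n) K)))
    ⟨fun i => sat (C (i + 1)), hmono⟩
  have hst : sat (C (N + 2)) = sat (C (N + 1)) := (hN (N + 1) (by omega)).symm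
  have hGN : G (N + 2) = groebnerBasis (sat (C (N + 1))) := hG (N + 2) (by omega)
  have hpair : IsCharacteristicPair (G (N + 2)) (C (N + 2)) := by
    refine ⟨?_, hC (N + 2) (by omega)⟩
    rw [hspan, hGN]
    exact groebnerBasis_spec _
  -- The chain stabilizes at `sat (C (N + 1))`. The witness is one step later, since `C (N + 2)` is
  -- the W-characteristic set of that ideal and has it as its saturated ideal.
  refine ⟨N + 2, by omega, hC₁ ▸ le_sat_wChar I, hmono (Nat.zero_le (N + 1)), ?_⟩
  by_cases htop : sat (C (N + 1)) = ⊤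
  · refine ⟨Or.inr (hst.trans htop), hpair, hst.trans (hspan N).symm, Or.inr ⟨?_, ?_⟩⟩
    · rw [hGN, htop, groebnerBasis_top]
    · rw [hCs, htop, wChar_top]
  · have hreg : IsRegularSet (C (N + 2)) := by
      have h := isRegularSet_wChar htop (by rw [← hCs, hst])
      rwa [← hCs] at h
    exact ⟨Or.inl hreg, hpair, hst.trans (hspan N).symm, Or.inl hreg⟩
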